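/- Let $n\ge 1$, let $\mathbb S^{n+1}\subset\mathbb R^{n+2}$ be the unit sphere with its round metric $\bar g$, and let $\mathcal S_\theta$ be the geodesic sphere of radius $\theta\in(0,\pi)$ about a point of $\mathbb S^{n+1}$, i.e. the set of points at geodesic distance $\theta$ from that point (the hypersurface $q_{n+1}=\theta$ in geodesic polar coordinates). For a hypersurface parametrised by $X$ in a Riemannian manifold $(N^{n+1},\bar g)$ with outer unit normal $\nu$, let $T_i=\partial X/\partial p^i$, let $g_{ij}=\bar g(T_i,T_j)$ be the induced metric with Levi-Civita connection $\nabla$, let $h_{ij}=\bar g(\bar\nabla_{T_i}\nu,T_j)$ and $h^i_j=g^{ik}h_{kj}$ (the Weingarten map), let $E_m$ be the $m$-th elementary symmetric function of the eigenvalues of $(h^i_j)$ (with $E_0=1$ and $E_{n+1}=0$), and let $\bar R(U,W)Z=\bar\nabla_W\bar\nabla_UZ-\bar\nabla_U\bar\nabla_WZ+\bar\nabla_{[U,W]}Z$. Define the weights, with summation over repeated indices, by \[ \Xi_a(X)=-\frac{g^{ik}}{(n+1)\binom{n}{n-a}}\left(\frac{\partial E_{n-a}}{\partial h^i_j}\,\bar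 g\big(\bar R(\nu,T_k)\nu,T_j\big)+\nabla_j\nabla_k\Big(\frac{\partial E_{n-a}}{\partial h^i_j}\Big)\right)+\binom{n+1}{n+1-a}^{-1}E_{n+1-a} \] for $a=0,\dots,n$, and $\Xi_{n+1}(X)=1$. Then for every local parametrisation $X_0$ of $\mathcal S_\theta\subset\mathbb S^{n+1}$, with $\nu$ pointing away from the centre, the weights are constant on $\mathcal S_\theta$, with \[ \Xi_a(X_0)=\begin{cases}\dfrac{\cot^{\,n-a-1}\theta}{n+1}\left(a\cot^2\theta-n+a\right)&\text{if }a=0,\dots,n,\\[2mm] 1&\text{if }a=n+1,\end{cases} \] where for $a=n$ the right-hand side is understood as $\frac{n}{n+1}\cot\theta$ (which also gives it a meaning at $\theta=\frac{\pi}{2}$, where $\cot^{-1}\theta$ is undefined). -/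

import Mathlib

open scoped ContDiff

noncomputable section

namespace CurvatureFlow

/-! ### Riemannian geometry in coordinates

A Riemannian metric on an open set of coordinates in `ℝᵐ` is the matrix-valued function
`G x a b = g_{ab}(x)`; its inverse matrix is `g^{ab}(x)`. -/

/-- The partial derivative `∂_i f` at `x`. -/
def pd {m : ℕ} {E : Type*} [NormedAddCommGroup E] [NormedSpace ℝ E]
    (f : (Fin m → ℝ) → E) (i : Fin m) (x : Fin m → ℝ) : E :=
  fderiv ℝ f x (Pi.single i 1)

/-- The inner product `g_x(u, v)`. -/
def metricInner {m : ℕ} (G : (Fin m → ℝ) → Matrix (Fin m) (Fin m) ℝ)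
    (x u v : Fin m → ℝ) : ℝ :=
  ∑ a, ∑ b, G x a b * u a * v b

/-- The Christoffel symbols `Γ^c_{ab}` of the Levi-Civita connection of `G`. -/
def christoffel {m : ℕ} (G : (Fin m → ℝ) → Matrix (Fin m) (Fin m) ℝ)
    (x : Fin m → ℝ) (c a b : Fin m) : ℝ :=
  (1 / 2) * ∑ d, (G x)⁻¹ c d *
    (pd (fun y => G y b d) a x + pd (fun y => G y a d) b x - pd (fun y => G y a b) d x)

/-- The vector with components `Γ^c_{ab} v^a u^b`. -/
def christoffelVec {m : ℕ} (G : (Fin m → ℝ) → Matrix (Fin m) (Fin m) ℝ)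
    (x v u : Fin m → ℝ) : Fin m → ℝ :=
  fun c => ∑ a, ∑ b, christoffel G x c a b * v a * u b

/-- The Levi-Civita covariant derivative `∇_V U` of a vector field `U` along a vector field `V`. -/
def covDeriv {m : ℕ} (G : (Fin m → ℝ) → Matrix (Fin m) (Fin m) ℝ)
    (V U : (Fin m → ℝ) → (Fin m → ℝ)) : (Fin m → ℝ) → (Fin m → ℝ) :=
  fun x => fderiv ℝ U x (V x) + christoffelVec G x (V x) (U x)

/-- The curvature `R(U, W) Z = ∇_W ∇_U Z - ∇_U ∇_W Z + ∇_{[U, W]} Z` of vector fields. -/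
def curvatureField {m : ℕ} (G : (Fin m → ℝ) → Matrix (Fin m) (Fin m) ℝ)
    (U W Z : (Fin m → ℝ) → (Fin m → ℝ)) : (Fin m → ℝ) → (Fin m → ℝ) :=
  fun x => covDeriv G W (covDeriv G U Z) x - covDeriv G U (covDeriv G W Z) x
    + covDeriv G (VectorField.lieBracket ℝ U W) Z x

/-- The curvature tensor `R(u, w) z` at `x` on tangent vectors; since the curvature is a tensor,
it may be computed on the extensions of `u`, `w`, `z` with constant components. -/
def curvature {m : ℕ} (G : (Fin m → ℝ) → Matrix (Fin m) (Fin m) ℝ)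
    (x u w z : Fin m → ℝ) : Fin m → ℝ :=
  curvatureField G (fun _ => u) (fun _ => w) (fun _ => z) x

/-- The covariant derivative of a `(1,1)` tensor field with components `P y j i = P^j_i(y)`:
`covDerivTensor G P y k j i = ∇_k P^j_i(y)`. -/
def covDerivTensor {m : ℕ} (G : (Fin m → ℝ) → Matrix (Fin m) (Fin m) ℝ)
    (P : (Fin m → ℝ) → Fin m → Fin m → ℝ) (y : Fin m → ℝ) (k j i : Fin m) : ℝ :=
  pd (fun z => P z j i) k y
    + ∑ l, christoffel G y j k l * P y l i - ∑ l, christoffel G y l k i * P y j l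

/-- The second covariant derivative of a `(1,1)` tensor field:
`covDerivTensor₂ G P y l k j i = ∇_l ∇_k P^j_i(y)`. -/
def covDerivTensor₂ {m : ℕ} (G : (Fin m → ℝ) → Matrix (Fin m) (Fin m) ℝ)
    (P : (Fin m → ℝ) → Fin m → Fin m → ℝ) (y : Fin m → ℝ) (l k j i : Fin m) : ℝ :=
  pd (fun z => covDerivTensor G P z k j i) l y
    - ∑ r, christoffel G y r l k * covDerivTensor G P y r j i
    + ∑ r, christoffel G y j l r * covDerivTensor G P y k r i
    - ∑ r, christoffel G y r l i * covDerivTensor G P y k j r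

/-! ### Elementary symmetric functions of the eigenvalues -/

/-- `E_k(A)`: the `k`-th elementary symmetric function of the eigenvalues of `A`, which are taken
in `ℂ` with multiplicity (the value is real for every real matrix `A`). -/
def elemSymm {n : ℕ} (k : ℕ) (A : Matrix (Fin n) (Fin n) ℝ) : ℝ :=
  ((A.map (fun r : ℝ => (r : ℂ))).charpoly.roots.esymm k).re

/-- The partial derivative `∂E_k / ∂h^i_j` at `A`, where `A i j = h^i_j`. -/
def elemSymmDeriv {n : ℕ} (k : ℕ) (A : Matrix (Fin n) (Fin n) ℝ) (i j : Fin n) : ℝ :=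
  deriv (fun t : ℝ => elemSymm k (A + t • Matrix.single i j (1 : ℝ))) 0

/-! ### Parametrised hypersurfaces

`G` is a metric in coordinates of the `(n+1)`-dimensional ambient manifold, `X` a parametrised
hypersurface in these coordinates and `ν` a unit normal field along `X`. -/

/-- The coordinate tangent vector `T_i = ∂X/∂p^i`. -/
def tangentVec {n : ℕ} (X : (Fin n → ℝ) → (Fin (n + 1) → ℝ)) (i : Fin n) (p : Fin n → ℝ) :
    Fin (n + 1) → ℝ :=
  pd X i p

/-- The induced metric `g_{ij} = g(T_i, T_j)`. -/
def inducedMetric {n : ℕ} (G : (Fin (n + 1) → ℝ) → Matrix (Fin (n + 1)) (Fin (n + 1)) ℝ)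
    (X : (Fin n → ℝ) → (Fin (n + 1) → ℝ)) (p : Fin n → ℝ) : Matrix (Fin n) (Fin n) ℝ :=
  Matrix.of fun i j => metricInner G (X p) (tangentVec X i p) (tangentVec X j p)

/-- The ambient covariant derivative `∇_{T_i} Y` of a vector field `Y` along `X`. -/
def covDerivAlong {n : ℕ} (G : (Fin (n + 1) → ℝ) → Matrix (Fin (n + 1)) (Fin (n + 1)) ℝ)
    (X Y : (Fin n → ℝ) → (Fin (n + 1) → ℝ)) (i : Fin n) (p : Fin n → ℝ) : Fin (n + 1) → ℝ :=
  pd Y i p + christoffelVec G (X p) (tangentVec X i p) (Y p)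

/-- The second fundamental form `h_{ij} = g(∇_{T_i} ν, T_j)`. -/
def secondFundForm {n : ℕ} (G : (Fin (n + 1) → ℝ) → Matrix (Fin (n + 1)) (Fin (n + 1)) ℝ)
    (X ν : (Fin n → ℝ) → (Fin (n + 1) → ℝ)) (p : Fin n → ℝ) : Matrix (Fin n) (Fin n) ℝ :=
  Matrix.of fun i j => metricInner G (X p) (covDerivAlong G X ν i p) (tangentVec X j p)

/-- The Weingarten map `h^i_j = g^{ik} h_{kj}`. -/
def weingarten {n : ℕ} (G : (Fin (n + 1) → ℝ) → Matrix (Fin (n + 1)) (Fin (n + 1)) ℝ)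
    (X ν : (Fin n → ℝ) → (Fin (n + 1) → ℝ)) (p : Fin n → ℝ) : Matrix (Fin n) (Fin n) ℝ :=
  (inducedMetric G X p)⁻¹ * secondFundForm G X ν p

/-- The weight function `Ξ_a(X)` at the parameter value `p`. For `a ≤ n` it is
`- g^{ik} / ((n+1) C(n,n-a)) * (∂E_{n-a}/∂h^i_j * g(R(ν,T_k)ν,T_j) + ∇_j ∇_k (∂E_{n-a}/∂h^i_j))
  + C(n+1,n+1-a)⁻¹ * E_{n+1-a}`
(summed over `i`, `j`, `k`), and it is `1` for `a = n + 1`. -/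
def weight {n : ℕ} (G : (Fin (n + 1) → ℝ) → Matrix (Fin (n + 1)) (Fin (n + 1)) ℝ)
    (X ν : (Fin n → ℝ) → (Fin (n + 1) → ℝ)) (a : ℕ) (p : Fin n → ℝ) : ℝ :=
  if a ≤ n then
    (∑ i, ∑ j, ∑ k,
      -((inducedMetric G X p)⁻¹ i k / ((n + 1 : ℝ) * (n.choose (n - a) : ℝ))) *
        (elemSymmDeriv (n - a) (weingarten G X ν p) i j *
            metricInner G (X p)
              (curvature G (X p) (ν p) (tangentVec X k p) (ν p)) (tangentVec X j p)
          + covDerivTensor₂ (inducedMetric G X)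
              (fun y j' i' => elemSymmDeriv (n - a) (weingarten G X ν y) i' j') p j k j i))
      + (((n + 1).choose (n + 1 - a) : ℕ) : ℝ)⁻¹ * elemSymm (n + 1 - a) (weingarten G X ν p)
  else 1

/-! ### Geodesic spheres in the round sphere -/

/-- `φ` is a smooth immersive parametrisation of an open part of the unit sphere `𝕊ⁿ⁺¹ ⊂ ℝⁿ⁺²`
by the open set `U` of coordinates in `ℝⁿ⁺¹`. -/
structure IsSphereCoord {n : ℕ} (U : Set (Fin (n + 1) → ℝ))
    (φ : (Fin (n + 1) → ℝ) → EuclideanSpace ℝ (Fin (n + 2))) : Prop where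
  isOpen : IsOpen U
  contDiffOn : ContDiffOn ℝ ∞ φ U
  norm_eq_one : ∀ q ∈ U, ‖φ q‖ = 1
  injective_fderiv : ∀ q ∈ U, Function.Injective (fderiv ℝ φ q)

/-- The round metric of the unit sphere in the coordinates `φ`. -/
def roundMetric {n : ℕ} (φ : (Fin (n + 1) → ℝ) → EuclideanSpace ℝ (Fin (n + 2)))
    (q : Fin (n + 1) → ℝ) : Matrix (Fin (n + 1)) (Fin (n + 1)) ℝ :=
  Matrix.of fun a b => inner ℝ (pd φ a q) (pd φ b q)

/-- In the coordinates `φ` on `U`, the map `X` is a smooth immersion of the open set `V` of `ℝⁿ`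
into the geodesic sphere with centre `N` and radius `θ`, and `ν` is its outer unit normal.
The geodesic distance of two points of the unit sphere is the angle between them; the outer normal
is the one along which the distance from the centre increases. -/
structure IsGeodesicSphereParam {n : ℕ} (U : Set (Fin (n + 1) → ℝ))
    (φ : (Fin (n + 1) → ℝ) → EuclideanSpace ℝ (Fin (n + 2)))
    (N : EuclideanSpace ℝ (Fin (n + 2))) (θ : ℝ)
    (V : Set (Fin n → ℝ)) (X ν : (Fin n → ℝ) → (Fin (n + 1) → ℝ)) : Prop where
  isOpen : IsOpen V
  mapsTo : Set.MapsTo X V U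
  contDiffOn : ContDiffOn ℝ ∞ X V
  injective_fderiv : ∀ p ∈ V, Function.Injective (fderiv ℝ X p)
  dist_eq : ∀ p ∈ V, InnerProductGeometry.angle N (φ (X p)) = θ
  normal_contDiffOn : ContDiffOn ℝ ∞ ν V
  normal_unit : ∀ p ∈ V, metricInner (roundMetric φ) (X p) (ν p) (ν p) = 1
  normal_orthogonal : ∀ p ∈ V, ∀ i : Fin n,
    metricInner (roundMetric φ) (X p) (ν p) (tangentVec X i p) = 0
  normal_outer : ∀ p ∈ V,
    0 < fderiv ℝ (fun q => InnerProductGeometry.angle N (φ q)) (X p) (ν p)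

end CurvatureFlow

end

open scoped ContDiff

noncomputable section

namespace CurvatureFlow

/-! ### Elementary symmetric functions near a multiple of the identity -/

/-! All computations are carried into ℝⁿ⁺² by `fderiv ℝ φ`, where the round metric becomes the
Euclidean inner product. Differentiating |φ|² = 1 gives the Gauss formula `fderiv_christoffelVec`:
the Levi-Civita connection is the flat derivative plus a multiple of the position vector. Since
third derivatives commute, it follows that the curvature is constant and equal to one
(`metricInner_curvature`).

On a geodesic sphere the fixed centre is N = cos θ · φ − sin θ · dφ(ν) (`center_eq`). Hence dφ(ν) =
cot θ · φ − N / sin θ, and one differentiation yields ∇_i ν = cot θ · T_i. The Weingarten map is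
therefore cot θ · 1 at every point, and ∂E_{n-a}/∂h is a constant multiple d of the identity tensor.
The term with second covariant derivatives vanishes, while the curvature term is d times the metric
and has trace n d. Two binomial identities turn the remaining expression into the stated one. -/

theorem esymm_replicate (m k : ℕ) (z : ℂ) :
    (Multiset.replicate m z).esymm k = (m.choose k : ℂ) * z ^ k := by
  rw [Multiset.esymm, Multiset.map_congr rfl (g := fun _ => z ^ k)]
  · simp
  · intro s hs
    rw [Multiset.mem_powersetCard] at hs
    rw [Multiset.eq_replicate_of_mem fun b hb =>
      Multiset.eq_of_mem_replicate (Multiset.mem_of_le hs.1 hb), Multiset.prod_replicate, hs.2]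

theorem esymm_cons_succ (s : Multiset ℂ) (z : ℂ) (k : ℕ) :
    (z ::ₘ s).esymm (k + 1) = s.esymm (k + 1) + z * s.esymm k := by
  simp [Multiset.esymm, Multiset.powersetCard_cons, Multiset.sum_map_mul_left]

/-- For i ≤ j the matrix is upper triangular, so its eigenvalues stand on the diagonal; the other
case follows by transposition. Size n + 1 allows the one possibly perturbed eigenvalue to be split
off. -/
theorem charpoly_smul_one_add_single {n : ℕ} (c t : ℂ) (i j : Fin (n + 1)) :
    (c • (1 : Matrix (Fin (n + 1)) (Fin (n + 1)) ℂ) + t • Matrix.single i j 1).charpoly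
      = (((if i = j then c + t else c) ::ₘ Multiset.replicate n c).map
          fun r => Polynomial.X - Polynomial.C r).prod := by
  have key : ∀ i j : Fin (n + 1), i ≤ j →
      (c • (1 : Matrix (Fin (n + 1)) (Fin (n + 1)) ℂ) + t • Matrix.single i j 1).charpoly
      = (((if i = j then c + t else c) ::ₘ Multiset.replicate n c).map
          fun r => Polynomial.X - Polynomial.C r).prod := by
    intro i j hij
    rw [Matrix.charpoly_of_isUpperTriangular, ← Finset.mul_prod_erase _ _ (Finset.mem_univ i)]
    · simp only [Multiset.map_cons, Multiset.prod_cons, Multiset.map_replicate,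
        Multiset.prod_replicate]
      congr 1
      · by_cases h : i = j <;> simp [h, eq_comm]
      · rw [Finset.prod_congr rfl (g := fun _ => Polynomial.X - Polynomial.C c)]
        · simp
        · intro k hk
          have : i ≠ k := (Finset.ne_of_mem_erase hk).symm
          simp [this]
    · intro a b hab
      have h1 : b < a := hab
      have : ¬ (i = a ∧ j = b) := by rintro ⟨rfl, rfl⟩; exact absurd hij (not_le.2 h1)
      simp [this, h1.ne']
  rcases le_total i j with h | h
  · exact key i j h
  · rw [← Matrix.charpoly_transpose]
    have := key j i h
    simp only [eq_comm (a := j)] at this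
    simpa [Matrix.transpose_add, Matrix.transpose_smul] using this

/-- The value is affine in t, and independent of t off the diagonal, so the partial derivatives at a
multiple of the identity can be read off. -/
theorem elemSymm_smul_one_add_single {n : ℕ} (k : ℕ) (c t : ℝ) (i j : Fin (n + 1)) :
    elemSymm (k + 1) (c • (1 : Matrix (Fin (n + 1)) (Fin (n + 1)) ℝ) + t • Matrix.single i j 1)
      = n.choose (k + 1) * c ^ (k + 1)
        + (if i = j then c + t else c) * (n.choose k * c ^ k) := by
  have h : (c • (1 : Matrix (Fin (n + 1)) (Fin (n + 1)) ℝ) + t • Matrix.single i j 1).map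
      (fun r : ℝ => (r : ℂ)) = (c : ℂ) • (1 : Matrix (Fin (n + 1)) (Fin (n + 1)) ℂ)
        + (t : ℂ) • Matrix.single i j 1 := by
    ext a b
    simp [Matrix.single_apply, Matrix.one_apply, apply_ite (Complex.ofReal)]
  rw [elemSymm, h, charpoly_smul_one_add_single, Polynomial.roots_multiset_prod_X_sub_C,
    esymm_cons_succ, esymm_replicate, esymm_replicate]
  have h2 : (if i = j then (c : ℂ) + t else c) = ((if i = j then c + t else c : ℝ) : ℂ) := by
    split_ifs <;> simp
  rw [h2]
  exact_mod_cast Complex.ofReal_re _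

theorem elemSymm_smul_one {n : ℕ} (k : ℕ) (c : ℝ) :
    elemSymm k (c • (1 : Matrix (Fin (n + 1)) (Fin (n + 1)) ℝ))
      = (n + 1).choose k * c ^ k := by
  cases k with
  | zero => simp [elemSymm, Multiset.esymm]
  | succ k =>
    have := elemSymm_smul_one_add_single k c 0 (0 : Fin (n + 1)) 0
    simp only [zero_smul, add_zero, if_true] at this
    rw [this, Nat.choose_succ_succ]
    push_cast
    ring

theorem elemSymmDeriv_zero {n : ℕ} (A : Matrix (Fin n) (Fin n) ℝ) (i j : Fin n) :
    elemSymmDeriv 0 A i j = 0 := by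
  simp [elemSymmDeriv, elemSymm, Multiset.esymm]

theorem elemSymmDeriv_succ_smul_one {n : ℕ} (k : ℕ) (c : ℝ) (i j : Fin (n + 1)) :
    elemSymmDeriv (k + 1) (c • (1 : Matrix (Fin (n + 1)) (Fin (n + 1)) ℝ)) i j
      = if i = j then n.choose k * c ^ k else 0 := by
  simp only [elemSymmDeriv, elemSymm_smul_one_add_single]
  split_ifs
  · simp
  · simp

/-! ### Riemannian geometry of the round sphere in coordinates -/

theorem sum_smul_single {m : ℕ} (u : Fin m → ℝ) :
    ∑ a, u a • (Pi.single a 1 : Fin m → ℝ) = u := by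
  ext b
  simp [Finset.sum_apply, Pi.single_apply]

theorem map_eq_sum_smul {m : ℕ} {E : Type*} [NormedAddCommGroup E] [NormedSpace ℝ E]
    (L : (Fin m → ℝ) →L[ℝ] E) (u : Fin m → ℝ) : L u = ∑ a, u a • L (Pi.single a 1) := by
  conv_lhs => rw [← sum_smul_single u]
  simp

theorem minSmoothness_two_le_infty : minSmoothness ℝ 2 ≤ (∞ : WithTop ℕ∞) := by
  rw [minSmoothness_of_isRCLikeNormedField]
  exact WithTop.coe_le_coe.2 (le_top : (2 : ℕ∞) ≤ ⊤)

variable {n : ℕ} {U : Set (Fin (n + 1) → ℝ)}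
  {φ : (Fin (n + 1) → ℝ) → EuclideanSpace ℝ (Fin (n + 2))}

theorem metricInner_roundMetric (φ : (Fin (n + 1) → ℝ) → EuclideanSpace ℝ (Fin (n + 2)))
    (x u v : Fin (n + 1) → ℝ) :
    metricInner (roundMetric φ) x u v = inner ℝ (fderiv ℝ φ x u) (fderiv ℝ φ x v) := by
  rw [map_eq_sum_smul _ u, map_eq_sum_smul _ v]
  simp only [metricInner, roundMetric, pd, Matrix.of_apply, sum_inner, inner_sum,
    real_inner_smul_left, real_inner_smul_right]
  rw [Finset.sum_comm]
  refine Finset.sum_congr rfl fun a _ => Finset.sum_congr rfl fun b _ => ?_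
  ring

namespace IsSphereCoord

theorem contDiffAt (hφ : IsSphereCoord U φ) {x : Fin (n + 1) → ℝ} (hx : x ∈ U) :
    ContDiffAt ℝ ∞ φ x :=
  hφ.contDiffOn.contDiffAt (hφ.isOpen.mem_nhds hx)

theorem differentiableAt (hφ : IsSphereCoord U φ) {x : Fin (n + 1) → ℝ} (hx : x ∈ U) :
    DifferentiableAt ℝ φ x :=
  (hφ.contDiffAt hx).differentiableAt (by simp)

theorem contDiffAt_fderiv (hφ : IsSphereCoord U φ) {x : Fin (n + 1) → ℝ} (hx : x ∈ U) :
    ContDiffAt ℝ ∞ (fderiv ℝ φ) x :=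
  (hφ.contDiffAt hx).fderiv_right (by simp)

theorem contDiffAt_fderiv_fderiv (hφ : IsSphereCoord U φ) {x : Fin (n + 1) → ℝ} (hx : x ∈ U) :
    ContDiffAt ℝ ∞ (fderiv ℝ (fderiv ℝ φ)) x :=
  (hφ.contDiffAt_fderiv hx).fderiv_right (by simp)

theorem differentiableAt_fderiv (hφ : IsSphereCoord U φ) {x : Fin (n + 1) → ℝ} (hx : x ∈ U) :
    DifferentiableAt ℝ (fderiv ℝ φ) x :=
  (hφ.contDiffAt_fderiv hx).differentiableAt (by simp)

theorem fderiv_fderiv_symm (hφ : IsSphereCoord U φ) {x : Fin (n + 1) → ℝ} (hx : x ∈ U)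
    (u v : Fin (n + 1) → ℝ) :
    fderiv ℝ (fderiv ℝ φ) x u v = fderiv ℝ (fderiv ℝ φ) x v u :=
  (hφ.contDiffAt hx).isSymmSndFDerivAt minSmoothness_two_le_infty u v

theorem inner_self (hφ : IsSphereCoord U φ) {x : Fin (n + 1) → ℝ} (hx : x ∈ U) :
    inner ℝ (φ x) (φ x) = 1 := by
  rw [real_inner_self_eq_norm_sq, hφ.norm_eq_one x hx, one_pow]

theorem fderiv_apply_const_apply (hφ : IsSphereCoord U φ) {x : Fin (n + 1) → ℝ} (hx : x ∈ U)
    (u w : Fin (n + 1) → ℝ) :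
    fderiv ℝ (fun y => fderiv ℝ φ y u) x w = fderiv ℝ (fderiv ℝ φ) x w u := by
  rw [fderiv_clm_apply (hφ.differentiableAt_fderiv hx) (differentiableAt_const u)]
  simp

theorem differentiableAt_fderiv_apply (hφ : IsSphereCoord U φ) {x : Fin (n + 1) → ℝ}
    (hx : x ∈ U) (u : Fin (n + 1) → ℝ) : DifferentiableAt ℝ (fun y => fderiv ℝ φ y u) x :=
  (hφ.differentiableAt_fderiv hx).clm_apply (differentiableAt_const u)

theorem inner_fderiv (hφ : IsSphereCoord U φ) {x : Fin (n + 1) → ℝ} (hx : x ∈ U)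
    (u : Fin (n + 1) → ℝ) : inner ℝ (φ x) (fderiv ℝ φ x u) = 0 := by
  have h1 : (fun y => inner ℝ (φ y) (φ y)) =ᶠ[nhds x] fun _ => (1 : ℝ) := by
    filter_upwards [hφ.isOpen.mem_nhds hx] with y hy using hφ.inner_self hy
  have h2 := h1.fderiv_eq (𝕜 := ℝ)
  have h3 := fderiv_inner_apply ℝ (hφ.differentiableAt hx) (hφ.differentiableAt hx) u
  rw [h2, real_inner_comm (φ x) (fderiv ℝ φ x u)] at h3
  simp only [fderiv_fun_const, Pi.zero_apply, zero_apply] at h3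
  linarith

/-- This is the derivative of ⟨φ, dφ(u)⟩ = 0: the normal component of the flat second derivative is
minus the metric. -/
theorem inner_fderiv_fderiv (hφ : IsSphereCoord U φ) {x : Fin (n + 1) → ℝ} (hx : x ∈ U)
    (u w : Fin (n + 1) → ℝ) :
    inner ℝ (φ x) (fderiv ℝ (fderiv ℝ φ) x w u)
      = -inner ℝ (fderiv ℝ φ x w) (fderiv ℝ φ x u) := by
  have h1 : (fun y => inner ℝ (φ y) (fderiv ℝ φ y u)) =ᶠ[nhds x] fun _ => (0 : ℝ) := by
    filter_upwards [hφ.isOpen.mem_nhds hx] with y hy using hφ.inner_fderiv hy u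
  have h2 := h1.fderiv_eq (𝕜 := ℝ)
  have h3 := fderiv_inner_apply ℝ (hφ.differentiableAt hx) (hφ.differentiableAt_fderiv_apply hx u) w
  rw [h2, hφ.fderiv_apply_const_apply hx] at h3
  simp only [fderiv_fun_const, Pi.zero_apply, zero_apply] at h3
  linarith

theorem fderiv_metric (hφ : IsSphereCoord U φ) {x : Fin (n + 1) → ℝ} (hx : x ∈ U)
    (u v w : Fin (n + 1) → ℝ) :
    fderiv ℝ (fun y => (inner ℝ (fderiv ℝ φ y u) (fderiv ℝ φ y v) : ℝ)) x w
      = inner ℝ (fderiv ℝ φ x u) (fderiv ℝ (fderiv ℝ φ) x w v)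
        + inner ℝ (fderiv ℝ (fderiv ℝ φ) x w u) (fderiv ℝ φ x v) := by
  rw [fderiv_inner_apply ℝ (hφ.differentiableAt_fderiv_apply hx u)
    (hφ.differentiableAt_fderiv_apply hx v) w, hφ.fderiv_apply_const_apply hx,
    hφ.fderiv_apply_const_apply hx]

/-- The position vector and the tangent vectors span the ambient Euclidean space. -/
theorem exists_eq_smul_add_fderiv (hφ : IsSphereCoord U φ) {x : Fin (n + 1) → ℝ} (hx : x ∈ U)
    (v : EuclideanSpace ℝ (Fin (n + 2))) : ∃ (s : ℝ) (u : Fin (n + 1) → ℝ),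
      v = s • φ x + fderiv ℝ φ x u := by
  let L : (ℝ × (Fin (n + 1) → ℝ)) →ₗ[ℝ] EuclideanSpace ℝ (Fin (n + 2)) :=
    (LinearMap.toSpanSingleton ℝ _ (φ x)).coprod (fderiv ℝ φ x).toLinearMap
  have hL : ∀ s u, L (s, u) = s • φ x + fderiv ℝ φ x u := fun s u => by simp [L]
  have hinj : Function.Injective L := by
    rw [← LinearMap.ker_eq_bot, LinearMap.ker_eq_bot']
    rintro ⟨s, u⟩ h
    rw [hL] at h
    have h1 := congrArg (fun z => (inner ℝ (φ x) z : ℝ)) h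
    simp only [inner_add_right, real_inner_smul_right, hφ.inner_self hx, hφ.inner_fderiv hx,
      inner_zero_right, mul_one, add_zero] at h1
    subst h1
    rw [zero_smul, zero_add, ← map_zero (fderiv ℝ φ x)] at h
    rw [hφ.injective_fderiv x hx h]
    rfl
  have hsurj : Function.Surjective L := by
    refine (LinearMap.injective_iff_surjective_of_finrank_eq_finrank ?_).1 hinj
    simp
    ring
  obtain ⟨⟨s, u⟩, h⟩ := hsurj v
  exact ⟨s, u, by rw [← h, hL]⟩

/-- Testing against the position vector and the tangent vectors separately is how vector identities
in ℝⁿ⁺² are proved below. -/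
theorem ext_inner (hφ : IsSphereCoord U φ) {x : Fin (n + 1) → ℝ} (hx : x ∈ U)
    {v w : EuclideanSpace ℝ (Fin (n + 2))} (h₀ : (inner ℝ (φ x) v : ℝ) = inner ℝ (φ x) w)
    (h : ∀ u, (inner ℝ (fderiv ℝ φ x u) v : ℝ) = inner ℝ (fderiv ℝ φ x u) w) : v = w := by
  refine ext_inner_left ℝ fun z => ?_
  obtain ⟨s, u, rfl⟩ := hφ.exists_eq_smul_add_fderiv hx z
  simp only [inner_add_left, real_inner_smul_left, h₀, h]

theorem linearIndependent_fderiv (hφ : IsSphereCoord U φ) {x : Fin (n + 1) → ℝ} (hx : x ∈ U) :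
    LinearIndependent ℝ (fun a => pd φ a x) := by
  rw [Fintype.linearIndependent_iff]
  intro g hg i
  have : fderiv ℝ φ x g = fderiv ℝ φ x 0 := by
    rw [map_eq_sum_smul]; simpa [pd] using hg
  exact congrFun (hφ.injective_fderiv x hx this) i

theorem det_roundMetric_ne_zero (hφ : IsSphereCoord U φ) {x : Fin (n + 1) → ℝ} (hx : x ∈ U) :
    (roundMetric φ x).det ≠ 0 :=
  Matrix.det_gram_ne_zero_iff_linearIndependent (𝕜 := ℝ).2 (hφ.linearIndependent_fderiv hx)

/-- The Christoffel symbols are the tangential components of ∂_a∂_b φ. The added multiple of φ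
cancels the normal component. -/
theorem fderiv_christoffel (hφ : IsSphereCoord U φ) {x : Fin (n + 1) → ℝ} (hx : x ∈ U)
    (a b : Fin (n + 1)) :
    fderiv ℝ φ x (fun c => christoffel (roundMetric φ) x c a b)
      = fderiv ℝ (fderiv ℝ φ) x (Pi.single a 1) (Pi.single b 1)
        + (inner ℝ (pd φ a x) (pd φ b x) : ℝ) • φ x := by
  refine hφ.ext_inner hx ?_ fun u => ?_
  · rw [hφ.inner_fderiv hx, inner_add_right, hφ.inner_fderiv_fderiv hx, real_inner_smul_right,
      hφ.inner_self hx]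
    simp [pd]
  · have hG : ∀ d, (inner ℝ (fderiv ℝ φ x (Pi.single d 1))
        (fderiv ℝ φ x (fun c => christoffel (roundMetric φ) x c a b)) : ℝ)
        = inner ℝ (fderiv ℝ φ x (Pi.single d 1))
          (fderiv ℝ (fderiv ℝ φ) x (Pi.single a 1) (Pi.single b 1)) := by
      intro d
      set S : Fin (n + 1) → ℝ := fun d => (1 / 2) * (pd (fun y => roundMetric φ y b d) a x
        + pd (fun y => roundMetric φ y a d) b x - pd (fun y => roundMetric φ y a b) d x) with hS
      have h1 : (fun c => christoffel (roundMetric φ) x c a b)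
          = (roundMetric φ x)⁻¹.mulVec S := by
        ext c
        simp only [christoffel, Matrix.mulVec, dotProduct, hS, Finset.mul_sum]
        refine Finset.sum_congr rfl fun d _ => ?_
        ring
      have h2 : (inner ℝ (fderiv ℝ φ x (Pi.single d 1))
          (fderiv ℝ φ x (fun c => christoffel (roundMetric φ) x c a b)) : ℝ)
          = (roundMetric φ x).mulVec (fun c => christoffel (roundMetric φ) x c a b) d := by
        rw [map_eq_sum_smul _ (fun c => christoffel (roundMetric φ) x c a b), inner_sum]
        simp only [real_inner_smul_right, Matrix.mulVec, dotProduct, roundMetric, pd,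
          Matrix.of_apply]
        exact Finset.sum_congr rfl fun c _ => mul_comm _ _
      rw [h2, h1, Matrix.mulVec_mulVec, Matrix.mul_nonsing_inv _
        (isUnit_iff_ne_zero.2 (hφ.det_roundMetric_ne_zero hx)), Matrix.one_mulVec]
      -- Each derivative of the metric splits into two terms. By symmetry of second derivatives all
      -- cancel except two copies of ⟨∂_d φ, ∂_a∂_b φ⟩, which the factor 1/2 absorbs.
      simp only [hS, pd, roundMetric, Matrix.of_apply, hφ.fderiv_metric hx]
      rw [hφ.fderiv_fderiv_symm hx (Pi.single b 1) (Pi.single a 1),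
        hφ.fderiv_fderiv_symm hx (Pi.single d 1) (Pi.single a 1),
        hφ.fderiv_fderiv_symm hx (Pi.single d 1) (Pi.single b 1),
        real_inner_comm (fderiv ℝ φ x (Pi.single d 1)),
        real_inner_comm (fderiv ℝ (fderiv ℝ φ) x (Pi.single a 1) (Pi.single d 1)),
        real_inner_comm (fderiv ℝ (fderiv ℝ φ) x (Pi.single b 1) (Pi.single d 1)) ]
      ring
    rw [inner_add_right, real_inner_smul_right, real_inner_comm (φ x), hφ.inner_fderiv hx,
      mul_zero, add_zero, map_eq_sum_smul _ u, sum_inner, sum_inner]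
    simp only [real_inner_smul_left, hG]

/-- The Gauss formula for the unit sphere. -/
theorem fderiv_christoffelVec (hφ : IsSphereCoord U φ) {x : Fin (n + 1) → ℝ} (hx : x ∈ U)
    (v u : Fin (n + 1) → ℝ) :
    fderiv ℝ φ x (christoffelVec (roundMetric φ) x v u)
      = fderiv ℝ (fderiv ℝ φ) x v u
        + (inner ℝ (fderiv ℝ φ x v) (fderiv ℝ φ x u) : ℝ) • φ x := by
  have h : christoffelVec (roundMetric φ) x v u
      = ∑ a, ∑ b, (v a * u b) • (fun c => christoffel (roundMetric φ) x c a b) := by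
    ext c
    simp only [christoffelVec, Finset.sum_apply, Pi.smul_apply, smul_eq_mul]
    refine Finset.sum_congr rfl fun a _ => Finset.sum_congr rfl fun b _ => ?_
    ring
  have h2 : fderiv ℝ (fderiv ℝ φ) x v u = ∑ a, ∑ b,
      (v a * u b) • fderiv ℝ (fderiv ℝ φ) x (Pi.single a 1) (Pi.single b 1) := by
    rw [map_eq_sum_smul _ u]
    simp only [map_eq_sum_smul (fderiv ℝ (fderiv ℝ φ) x) v]
    simp only [sum_apply, smul_apply, Finset.smul_sum]
    rw [Finset.sum_comm]
    refine Finset.sum_congr rfl fun a _ => Finset.sum_congr rfl fun b _ => ?_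
    rw [smul_smul, mul_comm]
  have h3 : (inner ℝ (fderiv ℝ φ x v) (fderiv ℝ φ x u) : ℝ) = ∑ a, ∑ b,
      (v a * u b) * inner ℝ (pd φ a x) (pd φ b x) := by
    rw [← metricInner_roundMetric]
    simp only [metricInner, roundMetric, Matrix.of_apply]
    refine Finset.sum_congr rfl fun a _ => Finset.sum_congr rfl fun b _ => ?_
    ring
  rw [h, h2, h3]
  simp only [map_sum, map_smul, hφ.fderiv_christoffel hx, smul_add, Finset.sum_add_distrib,
    Finset.sum_smul, smul_smul]

theorem differentiableAt_roundMetric (hφ : IsSphereCoord U φ) {x : Fin (n + 1) → ℝ} (hx : x ∈ U)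
    (a b : Fin (n + 1)) : DifferentiableAt ℝ (fun y => roundMetric φ y a b) x :=
  (hφ.differentiableAt_fderiv_apply hx _).inner ℝ (hφ.differentiableAt_fderiv_apply hx _)

theorem differentiableAt_pd_roundMetric (hφ : IsSphereCoord U φ) {x : Fin (n + 1) → ℝ}
    (hx : x ∈ U) (a b c : Fin (n + 1)) :
    DifferentiableAt ℝ (fun y => pd (fun z => roundMetric φ z a b) c y) x := by
  have h : ∀ d, ContDiffAt ℝ ∞ (fun y => pd φ d y) x := fun d =>
    (hφ.contDiffAt_fderiv hx).clm_apply contDiffAt_const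
  have h2 : ContDiffAt ℝ ∞ (fun z => roundMetric φ z a b) x := (h a).inner ℝ (h b)
  have h3 : ContDiffAt ℝ ∞ (fderiv ℝ (fun z => roundMetric φ z a b)) x :=
    h2.fderiv_right (by simp)
  exact (h3.differentiableAt (by simp)).clm_apply (differentiableAt_const _)

end IsSphereCoord

/-! ### Differentiability of determinants, inverse matrices and Christoffel symbols -/

theorem differentiableAt_det {m k : ℕ} {A : (Fin m → ℝ) → Matrix (Fin k) (Fin k) ℝ}
    {x : Fin m → ℝ} (h : ∀ a b, DifferentiableAt ℝ (fun y => A y a b) x) :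
    DifferentiableAt ℝ (fun y => (A y).det) x := by
  simp only [Matrix.det_apply]
  refine DifferentiableAt.fun_sum fun σ _ => ?_
  refine DifferentiableAt.const_smul 
    (HasFDerivAt.finsetProd fun i _ => (h _ _).hasFDerivAt).differentiableAt _

theorem differentiableAt_inv {m k : ℕ} {A : (Fin m → ℝ) → Matrix (Fin k) (Fin k) ℝ}
    {x : Fin m → ℝ} (h : ∀ a b, DifferentiableAt ℝ (fun y => A y a b) x) (hdet : (A x).det ≠ 0)
    (a b : Fin k) : DifferentiableAt ℝ (fun y => (A y)⁻¹ a b) x := by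
  simp only [Matrix.inv_def, Ring.inverse_eq_inv', Matrix.smul_apply, Matrix.adjugate_apply,
    smul_eq_mul]
  refine ((differentiableAt_det h).inv hdet).mul (differentiableAt_det fun c d => ?_)
  simp only [Matrix.updateRow_apply]
  split_ifs
  · exact differentiableAt_const _
  · exact h c d

namespace IsSphereCoord

theorem differentiableAt_christoffelVec (hφ : IsSphereCoord U φ) {x : Fin (n + 1) → ℝ}
    (hx : x ∈ U) (u z : Fin (n + 1) → ℝ) :
    DifferentiableAt ℝ (fun y => christoffelVec (roundMetric φ) y u z) x := by
  rw [differentiableAt_pi]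
  intro c
  simp only [christoffelVec, christoffel]
  refine DifferentiableAt.fun_sum fun a _ => DifferentiableAt.fun_sum fun b _ => ?_
  refine DifferentiableAt.mul_const (DifferentiableAt.mul_const
    (DifferentiableAt.const_mul (DifferentiableAt.fun_sum fun d _ => ?_) _) _) _
  have hp := fun a b c => hφ.differentiableAt_pd_roundMetric hx a b c
  exact (differentiableAt_inv (fun a b => hφ.differentiableAt_roundMetric hx a b)
    (hφ.det_roundMetric_ne_zero hx) c d).mul (((hp b d a).add (hp a d b)).sub (hp a b d))

/-- The Levi-Civita connection of the round metric is the tangential part of the flat one. -/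
theorem fderiv_covDeriv (hφ : IsSphereCoord U φ) {x : Fin (n + 1) → ℝ} (hx : x ∈ U)
    (W Y : (Fin (n + 1) → ℝ) → (Fin (n + 1) → ℝ)) (hY : DifferentiableAt ℝ Y x) :
    fderiv ℝ φ x (covDeriv (roundMetric φ) W Y x)
      = fderiv ℝ (fun y => fderiv ℝ φ y (Y y)) x (W x)
        + (inner ℝ (fderiv ℝ φ x (W x)) (fderiv ℝ φ x (Y x)) : ℝ) • φ x := by
  rw [covDeriv, map_add, hφ.fderiv_christoffelVec hx,
    fderiv_clm_apply (hφ.differentiableAt_fderiv hx) hY]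
  simp [add_assoc]

theorem covDeriv_const (φ : (Fin (n + 1) → ℝ) → EuclideanSpace ℝ (Fin (n + 2)))
    (u z : Fin (n + 1) → ℝ) :
    covDeriv (roundMetric φ) (fun _ => u) (fun _ => z)
      = fun y => christoffelVec (roundMetric φ) y u z := by
  ext y
  simp [covDeriv]

/-- The coefficient s is left unspecified because the multiple of φ disappears when paired with a
tangent vector. -/
theorem fderiv_covDeriv_covDeriv_const (hφ : IsSphereCoord U φ) {x : Fin (n + 1) → ℝ}
    (hx : x ∈ U) (u w z : Fin (n + 1) → ℝ) : ∃ s : ℝ,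
    fderiv ℝ φ x (covDeriv (roundMetric φ) (fun _ => w)
        (covDeriv (roundMetric φ) (fun _ => u) (fun _ => z)) x)
      = fderiv ℝ (fderiv ℝ (fderiv ℝ φ)) x w u z
        + (inner ℝ (fderiv ℝ φ x u) (fderiv ℝ φ x z) : ℝ) • fderiv ℝ φ x w + s • φ x := by
  rw [covDeriv_const, hφ.fderiv_covDeriv hx _ _ (hφ.differentiableAt_christoffelVec hx u z)]
  have h1 : (fun y => fderiv ℝ φ y (christoffelVec (roundMetric φ) y u z)) =ᶠ[nhds x]
      fun y => fderiv ℝ (fderiv ℝ φ) y u z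
        + (inner ℝ (fderiv ℝ φ y u) (fderiv ℝ φ y z) : ℝ) • φ y := by
    filter_upwards [hφ.isOpen.mem_nhds hx] with y hy using hφ.fderiv_christoffelVec hy u z
  have hd : DifferentiableAt ℝ (fderiv ℝ (fderiv ℝ φ)) x :=
    (hφ.contDiffAt_fderiv_fderiv hx).differentiableAt (by simp)
  have hdu : DifferentiableAt ℝ (fun y => fderiv ℝ (fderiv ℝ φ) y u) x :=
    hd.clm_apply (differentiableAt_const u)
  have hdz : DifferentiableAt ℝ (fun y => fderiv ℝ (fderiv ℝ φ) y u z) x :=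
    hdu.clm_apply (differentiableAt_const z)
  have hi : DifferentiableAt ℝ (fun y => (inner ℝ (fderiv ℝ φ y u) (fderiv ℝ φ y z) : ℝ)) x :=
    (hφ.differentiableAt_fderiv_apply hx u).inner ℝ (hφ.differentiableAt_fderiv_apply hx z)
  rw [h1.fderiv_eq, fderiv_fun_add hdz (hi.fun_smul (hφ.differentiableAt hx)),
    fderiv_clm_apply hdu (differentiableAt_const z),
    fderiv_clm_apply hd (differentiableAt_const u), fderiv_fun_smul hi (hφ.differentiableAt hx)]
  refine ⟨fderiv ℝ (fun y => (inner ℝ (fderiv ℝ φ y u) (fderiv ℝ φ y z) : ℝ)) x w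
    + inner ℝ (fderiv ℝ φ x w) (fderiv ℝ φ x (christoffelVec (roundMetric φ) x u z)), ?_⟩
  simp [add_smul, add_assoc]

/-- The unit sphere has constant curvature one. -/
theorem metricInner_curvature (hφ : IsSphereCoord U φ) {x : Fin (n + 1) → ℝ} (hx : x ∈ U)
    (u w z v : Fin (n + 1) → ℝ) :
    metricInner (roundMetric φ) x (curvature (roundMetric φ) x u w z) v
      = metricInner (roundMetric φ) x u z * metricInner (roundMetric φ) x w v
        - metricInner (roundMetric φ) x w z * metricInner (roundMetric φ) x u v := by
  obtain ⟨s, hs⟩ := hφ.fderiv_covDeriv_covDeriv_const hx u w z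
  obtain ⟨t, ht⟩ := hφ.fderiv_covDeriv_covDeriv_const hx w u z
  -- The third derivatives cancel in the commutator, which leaves only ⟨u, z⟩ w − ⟨w, z⟩ u in the
  -- tangential part.
  have hsymm : fderiv ℝ (fderiv ℝ (fderiv ℝ φ)) x w u = fderiv ℝ (fderiv ℝ (fderiv ℝ φ)) x u w :=
    (hφ.contDiffAt_fderiv hx).isSymmSndFDerivAt minSmoothness_two_le_infty w u
  have hzero : covDeriv (roundMetric φ) (VectorField.lieBracket ℝ (fun _ => u) (fun _ => w))
      (fun _ => z) x = 0 := by
    have : VectorField.lieBracket ℝ (fun _ : Fin (n + 1) → ℝ => u) (fun _ => w) x = 0 := by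
      simp [VectorField.lieBracket]
    ext c
    simp [covDeriv, this, christoffelVec]
  simp only [metricInner_roundMetric, curvature, curvatureField, hzero, add_zero, map_sub, hs, ht,
    hsymm, inner_sub_left, inner_add_left, real_inner_smul_left, hφ.inner_fderiv hx]
  ring

end IsSphereCoord

/-! ### Geodesic spheres in the round sphere -/

/-- A constant multiple of the identity tensor is parallel: its components are locally constant, and
its two Christoffel terms are both d Γ^j_{ki} and cancel. -/
theorem covDerivTensor_eq_zero_of_eventuallyEq {m : ℕ}
    (G : (Fin m → ℝ) → Matrix (Fin m) (Fin m) ℝ) {P : (Fin m → ℝ) → Fin m → Fin m → ℝ} {d : ℝ}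
    {y : Fin m → ℝ} (hP : ∀ᶠ z in nhds y, ∀ j i, P z j i = if i = j then d else 0)
    (k j i : Fin m) : covDerivTensor G P y k j i = 0 := by
  have h : (fun z => P z j i) =ᶠ[nhds y] fun _ => if i = j then d else 0 := by
    filter_upwards [hP] with z hz using hz j i
  rw [covDerivTensor, pd, h.fderiv_eq]
  simp [hP.self_of_nhds]

theorem covDerivTensor₂_eq_zero_of_eventuallyEq {m : ℕ}
    (G : (Fin m → ℝ) → Matrix (Fin m) (Fin m) ℝ) {P : (Fin m → ℝ) → Fin m → Fin m → ℝ} {d : ℝ}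
    {y : Fin m → ℝ} (hP : ∀ᶠ z in nhds y, ∀ j i, P z j i = if i = j then d else 0)
    (l k j i : Fin m) : covDerivTensor₂ G P y l k j i = 0 := by
  have h : (fun z => covDerivTensor G P z k j i) =ᶠ[nhds y] fun _ => 0 := by
    filter_upwards [hP.eventually_nhds] with z hz
      using covDerivTensor_eq_zero_of_eventuallyEq G hz k j i
  rw [covDerivTensor₂, pd, h.fderiv_eq]
  simp [covDerivTensor_eq_zero_of_eventuallyEq G hP]

variable {n : ℕ} {U : Set (Fin (n + 1) → ℝ)}
  {φ : (Fin (n + 1) → ℝ) → EuclideanSpace ℝ (Fin (n + 2))}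
  {N : EuclideanSpace ℝ (Fin (n + 2))} {θ : ℝ}
  {V : Set (Fin n → ℝ)} {X ν : (Fin n → ℝ) → (Fin (n + 1) → ℝ)}

namespace IsGeodesicSphereParam

theorem differentiableAt (hX : IsGeodesicSphereParam U φ N θ V X ν) {p : Fin n → ℝ}
    (hp : p ∈ V) : DifferentiableAt ℝ X p :=
  (hX.contDiffOn.contDiffAt (hX.isOpen.mem_nhds hp)).differentiableAt (by simp)

theorem normal_differentiableAt (hX : IsGeodesicSphereParam U φ N θ V X ν) {p : Fin n → ℝ}
    (hp : p ∈ V) : DifferentiableAt ℝ ν p :=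
  (hX.normal_contDiffOn.contDiffAt (hX.isOpen.mem_nhds hp)).differentiableAt (by simp)

theorem differentiableAt_comp (hX : IsGeodesicSphereParam U φ N θ V X ν)
    (hφ : IsSphereCoord U φ) {p : Fin n → ℝ} (hp : p ∈ V) :
    DifferentiableAt ℝ (fun y => φ (X y)) p :=
  _root_.DifferentiableAt.comp (g := φ) p (hφ.differentiableAt (hX.mapsTo hp)) (hX.differentiableAt hp)

theorem fderiv_comp (hX : IsGeodesicSphereParam U φ N θ V X ν) (hφ : IsSphereCoord U φ)
    {p : Fin n → ℝ} (hp : p ∈ V) (w : Fin n → ℝ) :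
    fderiv ℝ (fun y => φ (X y)) p w = fderiv ℝ φ (X p) (fderiv ℝ X p w) := by
  rw [fderiv_fun_comp p (hφ.differentiableAt (hX.mapsTo hp)) (hX.differentiableAt hp)]
  rfl

theorem inner_center (hX : IsGeodesicSphereParam U φ N θ V X ν) (hφ : IsSphereCoord U φ)
    (hN : ‖N‖ = 1) {p : Fin n → ℝ} (hp : p ∈ V) : (inner ℝ N (φ (X p)) : ℝ) = Real.cos θ := by
  rw [← hX.dist_eq p hp, InnerProductGeometry.cos_angle, hN, hφ.norm_eq_one _ (hX.mapsTo hp)]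
  simp

theorem inner_center_fderiv (hX : IsGeodesicSphereParam U φ N θ V X ν) (hφ : IsSphereCoord U φ)
    (hN : ‖N‖ = 1) {p : Fin n → ℝ} (hp : p ∈ V) (w : Fin n → ℝ) :
    (inner ℝ N (fderiv ℝ φ (X p) (fderiv ℝ X p w)) : ℝ) = 0 := by
  have h1 : (fun y => (inner ℝ N (φ (X y)) : ℝ)) =ᶠ[nhds p] fun _ => Real.cos θ := by
    filter_upwards [hX.isOpen.mem_nhds hp] with y hy using hX.inner_center hφ hN hy
  have h2 := fderiv_inner_apply ℝ (differentiableAt_const (x := p) N) (hX.differentiableAt_comp hφ hp) w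
  rw [h1.fderiv_eq, hX.fderiv_comp hφ hp] at h2
  simpa using h2.symm

theorem inner_normal_fderiv (hX : IsGeodesicSphereParam U φ N θ V X ν)
    {p : Fin n → ℝ} (hp : p ∈ V) (w : Fin n → ℝ) :
    (inner ℝ (fderiv ℝ φ (X p) (ν p)) (fderiv ℝ φ (X p) (fderiv ℝ X p w)) : ℝ) = 0 := by
  have h := hX.normal_orthogonal p hp
  simp only [metricInner_roundMetric, tangentVec, pd] at h
  rw [map_eq_sum_smul (fderiv ℝ X p) w]
  simp [inner_sum, real_inner_smul_right, h]

theorem inner_normal_normal (hX : IsGeodesicSphereParam U φ N θ V X ν)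
    {p : Fin n → ℝ} (hp : p ∈ V) :
    (inner ℝ (fderiv ℝ φ (X p) (ν p)) (fderiv ℝ φ (X p) (ν p)) : ℝ) = 1 := by
  rw [← metricInner_roundMetric, hX.normal_unit p hp]

/-- Orthogonality makes ν independent of the tangent space, and the dimensions 1 + n agree with the
ambient one. -/
theorem exists_eq_smul_normal_add (hX : IsGeodesicSphereParam U φ N θ V X ν)
    {p : Fin n → ℝ} (hp : p ∈ V) (u : Fin (n + 1) → ℝ) :
    ∃ (s : ℝ) (w : Fin n → ℝ), u = s • ν p + fderiv ℝ X p w := by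
  let L : (ℝ × (Fin n → ℝ)) →ₗ[ℝ] (Fin (n + 1) → ℝ) :=
    (LinearMap.toSpanSingleton ℝ _ (ν p)).coprod (fderiv ℝ X p).toLinearMap
  have hL : ∀ s w, L (s, w) = s • ν p + fderiv ℝ X p w := fun s w => by simp [L]
  have hinj : Function.Injective L := by
    rw [← LinearMap.ker_eq_bot, LinearMap.ker_eq_bot']
    rintro ⟨s, w⟩ h
    rw [hL] at h
    have h1 := congrArg (fun z => (inner ℝ (fderiv ℝ φ (X p) (ν p)) (fderiv ℝ φ (X p) z) : ℝ)) h
    simp only [map_add, map_smul, map_zero, inner_add_right, real_inner_smul_right,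
      hX.inner_normal_normal hp, hX.inner_normal_fderiv hp, inner_zero_right, mul_one,
      add_zero] at h1
    subst h1
    rw [zero_smul, zero_add, ← map_zero (fderiv ℝ X p)] at h
    rw [hX.injective_fderiv p hp h]
    rfl
  have hsurj : Function.Surjective L := by
    refine (LinearMap.injective_iff_surjective_of_finrank_eq_finrank ?_).1 hinj
    simp
    ring
  obtain ⟨⟨s, w⟩, h⟩ := hsurj u
  exact ⟨s, w, by rw [← h, hL]⟩

/-- The distance to the centre is arccos ⟨N, φ⟩, whose derivative along ν is −⟨N, dφ(ν)⟩ / sin θ;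
outwardness makes this positive. -/
theorem inner_center_normal_neg (hX : IsGeodesicSphereParam U φ N θ V X ν)
    (hφ : IsSphereCoord U φ) (hN : ‖N‖ = 1) (hθ₀ : 0 < θ) (hθπ : θ < Real.pi)
    {p : Fin n → ℝ} (hp : p ∈ V) : (inner ℝ N (fderiv ℝ φ (X p) (ν p)) : ℝ) < 0 := by
  have hU := hX.mapsTo hp
  have h1 : (fun q => InnerProductGeometry.angle N (φ q)) =ᶠ[nhds (X p)]
      fun q => Real.arccos (inner ℝ N (φ q)) := by
    filter_upwards [hφ.isOpen.mem_nhds hU] with q hq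
    simp [InnerProductGeometry.angle, hN, hφ.norm_eq_one q hq]
  have hs : 0 < Real.sin θ := Real.sin_pos_of_pos_of_lt_pi hθ₀ hθπ
  have hsc := Real.sin_sq_add_cos_sq θ
  have hdi : HasFDerivAt (fun q => (inner ℝ N (φ q) : ℝ))
      ((innerSL ℝ N).comp (fderiv ℝ φ (X p))) (X p) :=
    (innerSL ℝ N).hasFDerivAt.comp (X p) (hφ.differentiableAt hU).hasFDerivAt
  -- The side conditions cos θ ≠ ±1 follow from sin θ > 0.
  have hd := (Real.hasDerivAt_arccos (x := inner ℝ N (φ (X p)))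
    (by rw [hX.inner_center hφ hN hp]; nlinarith)
    (by rw [hX.inner_center hφ hN hp]; nlinarith)).comp_hasFDerivAt (X p) hdi
  have h := hX.normal_outer p hp
  rw [h1.fderiv_eq] at h
  have h2 : fderiv ℝ (fun q => Real.arccos (inner ℝ N (φ q))) (X p) = _ := hd.fderiv
  rw [h2, hX.inner_center hφ hN hp, ← Real.sin_sq, Real.sqrt_sq hs.le] at h
  simp only [smul_apply, ContinuousLinearMap.comp_apply, innerSL_apply_apply,
    smul_eq_mul] at h
  by_contra hcon
  have : 0 ≤ 1 / Real.sin θ * (inner ℝ N (fderiv ℝ φ (X p) (ν p)) : ℝ) :=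
    mul_nonneg (by positivity) (not_lt.1 hcon)
  linarith

/-- The centre of a geodesic sphere in terms of the position vector and the outer normal. -/
theorem center_eq (hX : IsGeodesicSphereParam U φ N θ V X ν)
    (hφ : IsSphereCoord U φ) (hN : ‖N‖ = 1) (hθ₀ : 0 < θ) (hθπ : θ < Real.pi)
    {p : Fin n → ℝ} (hp : p ∈ V) :
    N = Real.cos θ • φ (X p) - Real.sin θ • fderiv ℝ φ (X p) (ν p) := by
  have hU := hX.mapsTo hp
  set s : ℝ := inner ℝ N (fderiv ℝ φ (X p) (ν p)) with hs
  have h : N = Real.cos θ • φ (X p) + s • fderiv ℝ φ (X p) (ν p) := by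
    refine hφ.ext_inner hU ?_ fun u => ?_
    · rw [real_inner_comm, hX.inner_center hφ hN hp, inner_add_right, real_inner_smul_right,
        real_inner_smul_right, hφ.inner_self hU, hφ.inner_fderiv hU]
      ring
    · obtain ⟨t, w, rfl⟩ := hX.exists_eq_smul_normal_add hp u
      rw [real_inner_comm N, inner_add_right, real_inner_smul_right, real_inner_smul_right,
        real_inner_comm (φ (X p)), hφ.inner_fderiv hU, map_add, map_smul, inner_add_left,
        inner_add_right, real_inner_smul_left, real_inner_smul_right,
        hX.inner_normal_normal hp, hX.inner_center_fderiv hφ hN hp,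
        real_inner_comm (fderiv ℝ φ (X p) (ν p)) (fderiv ℝ φ (X p) (fderiv ℝ X p w)),
        hX.inner_normal_fderiv hp, ← hs]
      ring
  -- The unit length of N determines s up to sign; the outer normal then selects s = −sin θ.
  have hNN : (inner ℝ N N : ℝ) = Real.cos θ ^ 2 + s ^ 2 := by
    conv_lhs => rw [h]
    simp only [inner_add_left, inner_add_right, real_inner_smul_left, real_inner_smul_right,
      hφ.inner_self hU, hφ.inner_fderiv hU, hX.inner_normal_normal hp,
      real_inner_comm (φ (X p)) (fderiv ℝ φ (X p) (ν p))]
    ring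
  rw [real_inner_self_eq_norm_sq, hN] at hNN
  have hneg : s < 0 := hX.inner_center_normal_neg hφ hN hθ₀ hθπ hp
  have hsin : 0 < Real.sin θ := Real.sin_pos_of_pos_of_lt_pi hθ₀ hθπ
  have hsθ : s = -Real.sin θ := by
    have h2 : (s - Real.sin θ) * (s + Real.sin θ) = 0 := by
      linear_combination -hNN - Real.sin_sq_add_cos_sq θ
    rcases mul_eq_zero.1 h2 with h3 | h3 <;> linarith
  rw [h, hsθ, neg_smul, sub_eq_add_neg]

theorem fderiv_normal (hX : IsGeodesicSphereParam U φ N θ V X ν)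
    (hφ : IsSphereCoord U φ) (hN : ‖N‖ = 1) (hθ₀ : 0 < θ) (hθπ : θ < Real.pi)
    {p : Fin n → ℝ} (hp : p ∈ V) :
    fderiv ℝ φ (X p) (ν p) = Real.cot θ • φ (X p) - (Real.sin θ)⁻¹ • N := by
  have hsin : Real.sin θ ≠ 0 := (Real.sin_pos_of_pos_of_lt_pi hθ₀ hθπ).ne'
  have h := hX.center_eq hφ hN hθ₀ hθπ hp
  conv_rhs => rw [h]
  rw [smul_sub, smul_smul, smul_smul, inv_mul_cancel₀ hsin, Real.cot_eq_cos_div_sin,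
    div_eq_inv_mul, one_smul]
  abel

/-- By the Gauss formula, dφ(∇_i ν) is the flat derivative of dφ(ν) plus ⟨T_i, ν⟩ φ = 0. The flat
derivative is cot θ · dφ(T_i), since N is fixed. -/
theorem covDerivAlong_normal (hX : IsGeodesicSphereParam U φ N θ V X ν)
    (hφ : IsSphereCoord U φ) (hN : ‖N‖ = 1) (hθ₀ : 0 < θ) (hθπ : θ < Real.pi)
    {p : Fin n → ℝ} (hp : p ∈ V) (i : Fin n) :
    covDerivAlong (roundMetric φ) X ν i p = Real.cot θ • tangentVec X i p := by
  have hU := hX.mapsTo hp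
  refine hφ.injective_fderiv _ hU ?_
  rw [covDerivAlong, map_add, hφ.fderiv_christoffelVec hU, map_smul, ← metricInner_roundMetric]
  have horth : metricInner (roundMetric φ) (X p) (tangentVec X i p) (ν p) = 0 := by
    rw [metricInner_roundMetric, real_inner_comm, ← metricInner_roundMetric]
    exact hX.normal_orthogonal p hp i
  have h1 : (fun y => fderiv ℝ φ (X y) (ν y)) =ᶠ[nhds p]
      fun y => Real.cot θ • φ (X y) - (Real.sin θ)⁻¹ • N := by
    filter_upwards [hX.isOpen.mem_nhds hp] with y hy using hX.fderiv_normal hφ hN hθ₀ hθπ hy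
  have h2 : fderiv ℝ (fun y => fderiv ℝ φ (X y) (ν y)) p (Pi.single i 1)
      = fderiv ℝ φ (X p) (pd ν i p)
        + fderiv ℝ (fderiv ℝ φ) (X p) (tangentVec X i p) (ν p) := by
    have hd : HasFDerivAt (fun y => fderiv ℝ φ (X y)) _ p :=
      (hφ.differentiableAt_fderiv hU).hasFDerivAt.comp p (hX.differentiableAt hp).hasFDerivAt
    rw [fderiv_clm_apply hd.differentiableAt (hX.normal_differentiableAt hp), hd.fderiv]
    rfl
  rw [horth, zero_smul, add_zero, ← h2, h1.fderiv_eq, fderiv_sub_const,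
    fderiv_fun_const_smul (hX.differentiableAt_comp hφ hp), smul_apply, hX.fderiv_comp hφ hp]
  rfl

theorem inducedMetric_apply (φ : (Fin (n + 1) → ℝ) → EuclideanSpace ℝ (Fin (n + 2)))
    (X : (Fin n → ℝ) → (Fin (n + 1) → ℝ)) (p : Fin n → ℝ) (i j : Fin n) :
    inducedMetric (roundMetric φ) X p i j
      = inner ℝ (fderiv ℝ φ (X p) (tangentVec X i p)) (fderiv ℝ φ (X p) (tangentVec X j p)) := by
  rw [inducedMetric, Matrix.of_apply, metricInner_roundMetric]

theorem det_inducedMetric_ne_zero (hX : IsGeodesicSphereParam U φ N θ V X ν)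
    (hφ : IsSphereCoord U φ) {p : Fin n → ℝ} (hp : p ∈ V) :
    (inducedMetric (roundMetric φ) X p).det ≠ 0 := by
  have h : inducedMetric (roundMetric φ) X p
      = Matrix.gram ℝ (fun i => fderiv ℝ φ (X p) (tangentVec X i p)) := by
    ext i j
    rw [inducedMetric_apply, Matrix.gram_apply]
  rw [h, Matrix.det_gram_ne_zero_iff_linearIndependent, Fintype.linearIndependent_iff]
  intro g hg i
  have h2 : fderiv ℝ φ (X p) (fderiv ℝ X p g) = fderiv ℝ φ (X p) (fderiv ℝ X p 0) := by
    rw [map_eq_sum_smul (fderiv ℝ X p) g]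
    simpa [tangentVec, pd] using hg
  exact congrFun (hX.injective_fderiv p hp (hφ.injective_fderiv _ (hX.mapsTo hp) h2)) i

/-- Geodesic spheres are totally umbilical with principal curvatures `cot θ`. -/
theorem weingarten_eq (hX : IsGeodesicSphereParam U φ N θ V X ν)
    (hφ : IsSphereCoord U φ) (hN : ‖N‖ = 1) (hθ₀ : 0 < θ) (hθπ : θ < Real.pi)
    {p : Fin n → ℝ} (hp : p ∈ V) :
    weingarten (roundMetric φ) X ν p = Real.cot θ • (1 : Matrix (Fin n) (Fin n) ℝ) := by
  have h : secondFundForm (roundMetric φ) X ν p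
      = Real.cot θ • inducedMetric (roundMetric φ) X p := by
    ext i j
    rw [Matrix.smul_apply, inducedMetric_apply, secondFundForm, Matrix.of_apply,
      hX.covDerivAlong_normal hφ hN hθ₀ hθπ hp, metricInner_roundMetric, map_smul,
      real_inner_smul_left, smul_eq_mul]
  rw [weingarten, h, Matrix.mul_smul, Matrix.nonsing_inv_mul _
    (isUnit_iff_ne_zero.2 (hX.det_inducedMetric_ne_zero hφ hp))]

theorem metricInner_curvature_normal (hX : IsGeodesicSphereParam U φ N θ V X ν)
    (hφ : IsSphereCoord U φ) {p : Fin n → ℝ} (hp : p ∈ V) (k j : Fin n) :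
    metricInner (roundMetric φ) (X p)
        (curvature (roundMetric φ) (X p) (ν p) (tangentVec X k p) (ν p)) (tangentVec X j p)
      = inducedMetric (roundMetric φ) X p k j := by
  rw [hφ.metricInner_curvature (hX.mapsTo hp), hX.normal_unit p hp, hX.normal_orthogonal p hp,
    inducedMetric, Matrix.of_apply]
  ring

/-- The weights of a geodesic sphere, with `d` the common diagonal entry of `∂E_{n-a}/∂h`. -/
theorem weight_eq (hX : IsGeodesicSphereParam U φ N θ V X ν)
    (hφ : IsSphereCoord U φ) (hN : ‖N‖ = 1) (hθ₀ : 0 < θ) (hθπ : θ < Real.pi)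
    {p : Fin n → ℝ} (hp : p ∈ V) {a : ℕ} (ha : a ≤ n) {d : ℝ}
    (hd : ∀ i j : Fin n, elemSymmDeriv (n - a)
      (Real.cot θ • (1 : Matrix (Fin n) (Fin n) ℝ)) i j = if i = j then d else 0) :
    weight (roundMetric φ) X ν a p
      = -(n * d / ((n + 1) * n.choose (n - a)))
        + (((n + 1).choose (n + 1 - a) : ℕ) : ℝ)⁻¹
          * elemSymm (n + 1 - a) (Real.cot θ • (1 : Matrix (Fin n) (Fin n) ℝ)) := by
  -- A neighbourhood of p is needed, not just p, because the tensor is differentiated twice.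
  have hP : ∀ᶠ z in nhds p, ∀ j i,
      elemSymmDeriv (n - a) (weingarten (roundMetric φ) X ν z) i j = if i = j then d else 0 := by
    filter_upwards [hX.isOpen.mem_nhds hp] with z hz j i
    rw [hX.weingarten_eq hφ hN hθ₀ hθπ hz, hd]
  rw [weight, if_pos ha]
  simp only [covDerivTensor₂_eq_zero_of_eventuallyEq (inducedMetric (roundMetric φ) X) hP,
    hX.weingarten_eq hφ hN hθ₀ hθπ hp, hd, hX.metricInner_curvature_normal hφ hp, add_zero]
  congr 1
  set g := inducedMetric (roundMetric φ) X p with hg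
  have hinv : ∀ i, ∑ k, g⁻¹ i k * g k i = 1 := fun i => by
    rw [← Matrix.mul_apply, Matrix.nonsing_inv_mul _
      (isUnit_iff_ne_zero.2 (hX.det_inducedMetric_ne_zero hφ hp)), Matrix.one_apply_eq]
  -- Only j = i survives, and g^{ik} g_{ki} summed over k is 1; each i thus contributes the same
  -- amount.
  have h1 : ∀ i : Fin n, (∑ j, ∑ k, -(g⁻¹ i k / ((n + 1 : ℝ) * n.choose (n - a)))
      * ((if i = j then d else 0) * g k j)) = -(d / ((n + 1) * n.choose (n - a))) := by
    intro i
    rw [Finset.sum_eq_single i]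
    · rw [if_pos rfl, ← mul_one (-(d / _)), ← hinv i, Finset.mul_sum]
      refine Finset.sum_congr rfl fun k _ => ?_
      ring
    · intro j _ hj
      simp [hj.symm]
    · simp
  rw [Finset.sum_congr rfl fun i _ => h1 i]
  simp
  ring

end IsGeodesicSphereParam

end CurvatureFlow

end

/-! ### Evaluation of the weights by binomial identities -/

theorem mainTheorem10 (n : ℕ) (hn : 1 ≤ n) (θ : ℝ) (hθ₀ : 0 < θ) (hθπ : θ < Real.pi)
    (N : EuclideanSpace ℝ (Fin (n + 2))) (hN : ‖N‖ = 1)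
    (U : Set (Fin (n + 1) → ℝ)) (φ : (Fin (n + 1) → ℝ) → EuclideanSpace ℝ (Fin (n + 2)))
    (hφ : CurvatureFlow.IsSphereCoord U φ)
    (V : Set (Fin n → ℝ)) (X ν : (Fin n → ℝ) → (Fin (n + 1) → ℝ))
    (hX : CurvatureFlow.IsGeodesicSphereParam U φ N θ V X ν) :
    ∀ p ∈ V,
      (∀ a : ℕ, a ≤ n → (a = n → Real.cot θ ≠ 0) →
        CurvatureFlow.weight (CurvatureFlow.roundMetric φ) X ν a p
          = Real.cot θ ^ ((n : ℤ) - (a : ℤ) - 1) / ((n : ℝ) + 1)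
              * ((a : ℝ) * Real.cot θ ^ 2 - (n : ℝ) + (a : ℝ))) ∧
      CurvatureFlow.weight (CurvatureFlow.roundMetric φ) X ν n p
        = (n : ℝ) / ((n : ℝ) + 1) * Real.cot θ ∧
      CurvatureFlow.weight (CurvatureFlow.roundMetric φ) X ν (n + 1) p = 1 := by
  intro p hp
  have htop : CurvatureFlow.weight (CurvatureFlow.roundMetric φ) X ν n p
      = (n : ℝ) / ((n : ℝ) + 1) * Real.cot θ := by
    -- For a = n the derivative of E_0 = 1 vanishes, so only E_1 = n cot θ, divided by n + 1,
    -- contributes.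
    obtain ⟨m, rfl⟩ : ∃ m, n = m + 1 := ⟨n - 1, by omega⟩
    rw [hX.weight_eq hφ hN hθ₀ hθπ hp le_rfl (d := 0)
      (by simp [CurvatureFlow.elemSymmDeriv_zero]), CurvatureFlow.elemSymm_smul_one]
    rw [Nat.add_sub_cancel_left, Nat.choose_one_right, Nat.choose_one_right]
    push_cast
    ring
  refine ⟨fun a ha hcot => ?_, htop, ?_⟩
  · rcases ha.eq_or_lt with rfl | hlt
    · have hc := hcot rfl
      rw [htop, sub_self, zero_sub, zpow_neg_one]
      field_simp
      ring
    -- Here l = n − a − 1 is a natural number, so the integer power of cot θ is an ordinary one.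
    · obtain ⟨k, l, rfl, rfl⟩ : ∃ k l, n = k + 1 ∧ k = a + l :=
        ⟨n - 1, n - 1 - a, by omega, by omega⟩
      have h1 : a + l + 1 - a = l + 1 := by omega
      have h2 : a + l + 1 + 1 - a = l + 2 := by omega
      rw [hX.weight_eq hφ hN hθ₀ hθπ hp ha
        (by rw [h1]; exact CurvatureFlow.elemSymmDeriv_succ_smul_one l _),
        CurvatureFlow.elemSymm_smul_one, h1, h2]
      -- Absorption, n C(n−1, l) = (l+1) C(n, l+1), gives the curvature term the coefficient l + 1 =
      -- n − a.
      have h3 : ((a + l + 1 : ℕ) : ℝ) * ((a + l).choose l : ℕ)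
          = ((a + l + 1).choose (l + 1) : ℕ) * ((l + 1 : ℕ) : ℝ) := by
        exact_mod_cast Nat.add_one_mul_choose_eq (a + l) l
      -- Here C(n, l+2) / C(n+1, l+2) = a / (n+1). At a = 0 both sides are zero, in accordance with
      -- E_{n+1} = 0.
      have h4 : ((a + l + 1).choose (l + 2) : ℝ) * ((a + l + 1 + 1 : ℕ) : ℝ)
          = ((a + l + 1 + 1).choose (l + 2) : ℕ) * (a : ℝ) := by
        have := Nat.choose_mul_succ_eq (a + l + 1) (l + 2)
        rw [show a + l + 1 + 1 - (l + 2) = a by omega] at this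
        exact_mod_cast this
      have hz : (((a + l + 1 : ℕ) : ℤ) - (a : ℤ) - 1) = (l : ℤ) := by push_cast; ring
      rw [hz, zpow_natCast]
      have h5 : ((a + l + 1).choose (l + 1) : ℝ) ≠ 0 :=
        Nat.cast_ne_zero.2 (Nat.choose_pos (by omega)).ne'
      have h6 : ((a + l + 1 + 1).choose (l + 2) : ℝ) ≠ 0 :=
        Nat.cast_ne_zero.2 (Nat.choose_pos (by omega)).ne'
      have h7 : ((a + l + 1 : ℕ) : ℝ) + 1 ≠ 0 := by positivity
      have h8 : ((a + l + 1 : ℕ) : ℝ) = a + l + 1 := by push_cast; ring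
      have e1 : ((a + l + 1 : ℕ) : ℝ) * (((a + l).choose l : ℕ) * Real.cot θ ^ l)
          / ((((a + l + 1 : ℕ) : ℝ) + 1) * ((a + l + 1).choose (l + 1) : ℕ))
          = (l + 1) * Real.cot θ ^ l / (((a + l + 1 : ℕ) : ℝ) + 1) := by
        rw [← mul_assoc, h3, div_eq_div_iff (mul_ne_zero h7 h5) h7]
        push_cast
        ring
      have e2 : (((a + l + 1 + 1).choose (l + 2) : ℕ) : ℝ)⁻¹
          * (((a + l + 1).choose (l + 2) : ℕ) * Real.cot θ ^ (l + 2))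
          = a * Real.cot θ ^ (l + 2) / (((a + l + 1 : ℕ) : ℝ) + 1) := by
        rw [inv_mul_eq_div, div_eq_div_iff h6 h7]
        push_cast at h4 ⊢
        linear_combination Real.cot θ ^ (l + 2) * h4
      rw [e1, e2, h8]
      ring
  · simp [CurvatureFlow.weight]
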